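/- Let $n\ge 1$ and let $s=(s_1,\dots,s_n)$ be a sequence of independent random variables, each uniformly distributed on $\{1,\dots,n\}$. The algorithm Linear sets $g\leftarrow$ True; then for $i=1,\dots,n$ it sets $v_i\leftarrow 0$; then for $i=1,\dots,n$ it tests whether $v_{s_i}>0$, and if so sets $g\leftarrow$ False and returns $g$, otherwise sets $v_{s_i}\leftarrow v_{s_i}+1$; after the last loop it returns $g$. Its running time is the number of these assignments (to $g$ and to entries of $v$) plus the number of these comparisons $v_{s_i}>0$ (the administration of the loop variable is not counted). Put $$\kappa(n)=\frac13-\sqrt{\frac{\pi n}{2}}+\sum_{k=1}^{n}\frac{n!\,k^2}{(n-k)!\,n^{k+1}},\qquad \delta(n)=\kappa(n)-\frac{n!}{n^n}.$$ Then the expected running time $T_L(n)$ of Linear is $$T_L(n)=n+\sqrt{2\pi n}+\frac73+2\,\delta(n)\qquad(n\ge 1),$$ where $\delta(n)\to 0$ as $n\to\infty$. Moreover, $\delta(n+1)>\delta(n)$ for $1\le n\le 7$ and $\delta(n+1)<\delta(n)$ for all $n\ge 8$. -/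

import Mathlib

open MeasureTheory ProbabilityTheory Filter Topology
open scoped Nat

namespace LinearTest

/-- A configuration of the algorithm `Linear` on sequences of length `n`: the logical variable `g`,
the working vector `v` (indexed by the `n` possible values of the input elements), and the numbers
of assignments and of comparisons carried out so far. -/
structure Config (n : ℕ) where
  g : Bool
  v : Fin n → ℕ
  assignments : ℕ
  comparisons : ℕ

/-- The assignment `g ← b`. -/
def Config.assignG {n : ℕ} (c : Config n) (b : Bool) : Config n :=
  { c with g := b, assignments := c.assignments + 1 }

/-- The assignment `v_k ← a`. -/
def Config.assignV {n : ℕ} (c : Config n) (k : Fin n) (a : ℕ) : Config n :=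
  { c with v := Function.update c.v k a, assignments := c.assignments + 1 }

/-- The cost of one comparison. -/
def Config.tickComparison {n : ℕ} (c : Config n) : Config n :=
  { c with comparisons := c.comparisons + 1 }

/-- First loop: for every `i` in the list, `v_i ← 0`. -/
def clearLoop {n : ℕ} : List (Fin n) → Config n → Config n
  | [], c => c
  | i :: is, c => clearLoop is (c.assignV i 0)

/-- Second loop: for every `i` in the list, if `v_{s_i} > 0` then `g ← False` and return, else
`v_{s_i} ← v_{s_i} + 1` and go on. -/
def testLoop {n : ℕ} (s : Fin n → Fin n) : List (Fin n) → Config n → Config n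
  | [], c => c
  | i :: is, c =>
    if 0 < c.v (s i) then
      c.tickComparison.assignG false
    else
      testLoop s is (c.tickComparison.assignV (s i) (c.v (s i) + 1))

/-- The algorithm `Linear` on the input `s`, started with arbitrary contents `g₀`, `v₀` of the
variables: `g ← True`, then the first loop and the second loop, each for `i` from first to last.
The output is the component `g` of the final configuration. -/
def run {n : ℕ} (g₀ : Bool) (v₀ : Fin n → ℕ) (s : Fin n → Fin n) : Config n :=
  testLoop s (List.finRange n)
    (clearLoop (List.finRange n)
      (Config.assignG { g := g₀, v := v₀, assignments := 0, comparisons := 0 } true))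

/-- The running time of `Linear`: the number of assignments plus the number of comparisons. -/
def runningTime {n : ℕ} (g₀ : Bool) (v₀ : Fin n → ℕ) (s : Fin n → Fin n) : ℕ :=
  (run g₀ v₀ s).assignments + (run g₀ v₀ s).comparisons

/-- `κ(n) = 1/3 - √(πn/2) + ∑_{k=1}^n n! k² / ((n-k)! n^{k+1})`. -/
noncomputable def kappa (n : ℕ) : ℝ :=
  1 / 3 - √(Real.pi * n / 2) +
    ∑ k ∈ Finset.Icc 1 n, ((n ! : ℝ) * (k : ℝ) ^ 2) / (((n - k)! : ℝ) * (n : ℝ) ^ (k + 1))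

/-- `δ(n) = κ(n) - n! / n^n`. -/
noncomputable def delta (n : ℕ) : ℝ :=
  kappa n - (n ! : ℝ) / (n : ℝ) ^ n

end LinearTest

namespace LinearTest

/-! Iteration j of the second loop (counted from 0) is reached exactly when the first j inputs are
distinct, and costs 2. Hence the expected time is n + 1 + 2 ∑_{j<n} a_j with a_j =
n(n-1)⋯(n-j+1)/n^j. Abel summation identifies κ(n) with ∑_{k≤n} a_k - 2/3 - √(πn/2), and δ(n) is the
same without the term a_n = n!/n^n.

For the asymptotics put L(y) = y - log(1+y) and u = √(2L). Then ∑_{k≤n} a_k = n∫ e^{-nL}, √(πn/2) =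
n∫ e^{-nL} u', and 1 = n∫ e^{-nL} L', all over (0,∞). Since 1 - u' - (2/3)L' = L'·K with K = 1/y -
1/u + 1/3, integration by parts gives κ(n) = ∫ e^{-nL} K' (`kappa_eq_integral`). The inequality
u³(1+y) ≤ y³ makes K' nonnegative, and K is bounded, so K' is integrable. Thus κ(n) → 0 by dominated
convergence, and κ(n) - κ(n+1) has a lower bound of order (2/e)^n, obtained on (1/4, 1]. This beats
n!/n^n, which at least halves at each step, from n = 16 on. Smaller n are settled by numerical
bounds for the square roots. -/

/-! ### Operation count of a single run -/

/-- The total number of operations recorded in a configuration. -/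
def Config.cost {n : ℕ} (c : Config n) : ℕ := c.assignments + c.comparisons

theorem cost_clearLoop {n : ℕ} (l : List (Fin n)) (c : Config n) :
    (clearLoop l c).cost = c.cost + l.length := by
  induction l generalizing c with
  | nil => simp [clearLoop]
  | cons i l ih =>
    simp only [clearLoop, ih, List.length_cons]
    simp only [Config.cost, Config.assignV]
    omega

theorem clearLoop_v_eq_zero {n : ℕ} (l : List (Fin n)) (c : Config n) (k : Fin n)
    (h : k ∈ l ∨ c.v k = 0) : (clearLoop l c).v k = 0 := by
  induction l generalizing c with
  | nil => simpa [clearLoop] using h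
  | cons i l ih =>
    simp only [clearLoop]
    apply ih
    by_cases hk : k = i
    · right; simp [Config.assignV, hk]
    · simpa [Config.assignV, hk] using h

/-- Every iteration that is reached costs one comparison and one assignment, whether it stops or
goes on. The initial vector is arbitrary because the induction changes it: after the first step the
cell `s i` is occupied, which is how freshness of cells turns into distinctness of inputs. -/
theorem cost_testLoop {n : ℕ} (s : Fin n → Fin n) (l : List (Fin n)) (c : Config n) :
    (testLoop s l c).cost = c.cost + 2 * ∑ j ∈ Finset.range l.length,
      if ((l.take j).map s).Nodup ∧ ∀ i ∈ l.take j, c.v (s i) = 0 then 1 else 0 := by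
  induction l generalizing c with
  | nil => simp [testLoop]
  | cons i l ih =>
    rw [List.length_cons, Finset.sum_range_succ']
    simp only [testLoop, List.take_succ_cons, List.map_cons, List.nodup_cons, List.mem_cons,
      forall_eq_or_imp, List.take_zero, List.map_nil, List.nodup_nil, List.not_mem_nil,
      false_imp_iff, implies_true, and_self, if_true]
    split_ifs with h
    · rw [Finset.sum_eq_zero]
      · simp only [Config.cost, Config.assignG, Config.tickComparison]
        omega
      · intro j _
        rw [if_neg]
        omega
    · have h0 : c.v (s i) = 0 := by omega
      rw [ih, mul_add, mul_one]
      have hs : ∀ j, ((((l.take j).map s).Nodup ∧ ∀ k ∈ l.take j,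
          (c.tickComparison.assignV (s i) (c.v (s i) + 1)).v (s k) = 0) ↔
          ((s i ∉ (l.take j).map s ∧ ((l.take j).map s).Nodup) ∧
            c.v (s i) = 0 ∧ ∀ k ∈ l.take j, c.v (s k) = 0)) := by
        intro j
        have hu : ∀ k, (c.tickComparison.assignV (s i) (c.v (s i) + 1)).v (s k) = 0 ↔
            s k ≠ s i ∧ c.v (s k) = 0 := by
          intro k
          by_cases hk : s k = s i
          · simp [Config.assignV, Config.tickComparison, hk]
          · simp [Config.assignV, Config.tickComparison, hk]
        simp only [hu, List.mem_map, not_exists, not_and]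
        simp only [h0, true_and]
        constructor
        · rintro ⟨h1, h2⟩
          exact ⟨⟨fun k hk => (h2 k hk).1, h1⟩, fun k hk => (h2 k hk).2⟩
        · rintro ⟨⟨h1, h2⟩, h3⟩
          exact ⟨h2, fun k hk => ⟨h1 k hk, h3 k hk⟩⟩
      simp only [hs]
      simp only [Config.cost, Config.assignV, Config.tickComparison]
      omega

theorem take_finRange {n j : ℕ} (h : j ≤ n) :
    (List.finRange n).take j = (List.finRange j).map (Fin.castLE h) := by
  apply List.ext_getElem
  · simp [h]
  · intro i h1 h2
    simp

theorem nodup_map_finRange {α : Type*} {j : ℕ} (f : Fin j → α) :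
    ((List.finRange j).map f).Nodup ↔ Function.Injective f := by
  rw [← List.ofFn_eq_map, List.nodup_ofFn]

open Classical in
theorem runningTime_eq {n : ℕ} (g₀ : Bool) (v₀ : Fin n → ℕ) (s : Fin n → Fin n) :
    runningTime g₀ v₀ s = n + 1 + 2 * ∑ j : Fin n,
      if Function.Injective (fun i : Fin j => s (Fin.castLE j.2.le i)) then 1 else 0 := by
  have h1 : runningTime g₀ v₀ s = (run g₀ v₀ s).cost := rfl
  rw [h1, run, cost_testLoop, cost_clearLoop, List.length_finRange, Finset.sum_range]
  congr 1
  · simp [Config.cost, Config.assignG, add_comm]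
  · congr 1
    refine Finset.sum_congr rfl fun j _ => ?_
    simp only [take_finRange j.2.le, List.map_map, nodup_map_finRange]
    refine if_congr (and_iff_left fun i _ => ?_) rfl rfl
    exact clearLoop_v_eq_zero _ _ _ (Or.inl (List.mem_finRange _))

/-! ### Expected running time -/

theorem measureReal_injective {Ω : Type*} [MeasurableSpace Ω] {P : Measure Ω}
    [IsProbabilityMeasure P] {n j : ℕ} {x : Fin j → Ω → Fin n} (hx : ∀ i, Measurable (x i))
    (hind : iIndepFun x P) (hunif : ∀ i k, P.real {ω | x i ω = k} = 1 / (n : ℝ)) :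
    P.real {ω | Function.Injective (fun i => x i ω)} = (n.descFactorial j : ℝ) / (n : ℝ) ^ j := by
  classical
  have hpt : ∀ t : Fin j → Fin n, P.real {ω | (fun i => x i ω) = t} = (1 / (n : ℝ)) ^ j := by
    intro t
    have h1 : {ω | (fun i => x i ω) = t} = ⋂ i, {ω | x i ω = t i} := by
      ext ω; simp [funext_iff]
    have h2 := hind.meas_iInter (s := fun i => {ω | x i ω = t i})
      (fun i => ⟨{t i}, MeasurableSet.singleton _, rfl⟩)
    rw [h1, measureReal_def, h2, ENNReal.toReal_prod]
    simp only [← measureReal_def, hunif]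
    simp
  have hX : Measurable (fun ω => fun i => x i ω) := measurable_pi_lambda _ hx
  have h3 : {ω | Function.Injective (fun i => x i ω)} =
      ⋃ t ∈ (Finset.univ.filter fun t : Fin j → Fin n => Function.Injective t),
        {ω | (fun i => x i ω) = t} := by
    ext ω; simp
  rw [h3, measureReal_biUnion_finset]
  · simp only [hpt, Finset.sum_const, nsmul_eq_mul]
    have : (Finset.univ.filter fun t : Fin j → Fin n => Function.Injective t).card
        = n.descFactorial j := by
      rw [← Fintype.card_subtype, Fintype.card_congr (Equiv.subtypeInjectiveEquivEmbedding _ _),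
        Fintype.card_embedding_eq]
      simp
    rw [this, one_div, inv_pow, div_eq_mul_inv]
  · intro t _ t' _ htt
    refine Set.disjoint_left.2 fun ω h h' => htt ?_
    exact h.symm.trans h'
  · intro t _
    exact hX (measurableSet_singleton t)

theorem integral_runningTime {n : ℕ} {Ω : Type*} [MeasurableSpace Ω] {P : Measure Ω}
    [IsProbabilityMeasure P] {x : Fin n → Ω → Fin n} (hx : ∀ i, Measurable (x i))
    (hind : iIndepFun x P) (hunif : ∀ i k, P.real {ω | x i ω = k} = 1 / (n : ℝ))
    (g₀ : Bool) (v₀ : Fin n → ℕ) :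
    ∫ ω, (runningTime g₀ v₀ (fun i => x i ω) : ℝ) ∂P =
      n + 1 + 2 * ∑ j ∈ Finset.range n, (n.descFactorial j : ℝ) / (n : ℝ) ^ j := by
  classical
  have hset : ∀ j : Fin n, MeasurableSet
      {ω | Function.Injective (fun i : Fin j => x (Fin.castLE j.2.le i) ω)} := by
    intro j
    have hX : Measurable (fun ω => fun i : Fin j => x (Fin.castLE j.2.le i) ω) :=
      measurable_pi_lambda _ fun i => hx _
    exact hX (Set.toFinite {t : Fin j → Fin n | Function.Injective t}).measurableSet
  have hrt : ∀ ω, (runningTime g₀ v₀ (fun i => x i ω) : ℝ) = (n + 1 : ℝ) + 2 * ∑ j : Fin n,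
      Set.indicator {ω | Function.Injective (fun i : Fin j => x (Fin.castLE j.2.le i) ω)}
        (fun _ => (1 : ℝ)) ω := by
    intro ω
    rw [runningTime_eq]
    push_cast
    congr 2
    refine Finset.sum_congr rfl fun j _ => ?_
    simp [Set.indicator_apply]
  have hint : ∀ j : Fin n, Integrable (Set.indicator
      {ω | Function.Injective (fun i : Fin j => x (Fin.castLE j.2.le i) ω)}
        (fun _ => (1 : ℝ))) P := fun j => (integrable_const _).indicator (hset j)
  simp only [hrt]
  rw [integral_add (integrable_const _) ((integrable_finsetSum _ fun j _ => hint j).const_mul 2),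
    integral_const_mul, integral_finsetSum _ fun j _ => hint j, Finset.sum_range]
  congr 1
  · simp
  · congr 1
    refine Finset.sum_congr rfl fun j _ => ?_
    rw [integral_indicator_const _ (hset j), smul_eq_mul, mul_one]
    exact measureReal_injective (x := fun i : Fin j => x (Fin.castLE j.2.le i)) (fun i => hx _)
      (hind.precomp (Fin.castLE_injective _)) (fun i k => hunif _ k)

/-! ### Rewriting κ and δ as sums of falling factorials -/

theorem descFactorial_succ_div {n k : ℕ} (hn : 1 ≤ n) (hk : k ≤ n) :
    (n.descFactorial (k + 1) : ℝ) / (n : ℝ) ^ (k + 1) =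
      (n.descFactorial k : ℝ) / (n : ℝ) ^ k * (1 - k / n) := by
  have : (n : ℝ) ≠ 0 := by positivity
  rw [Nat.descFactorial_succ, Nat.cast_mul, Nat.cast_sub hk]
  field_simp
  ring

/-- With a_k = `n.descFactorial k / n ^ k`, the recurrence gives k·a_k/n = a_k - a_{k+1}, so the
summand is k(a_k - a_{k+1}) and the sum is an Abel summation. The boundary term is kept so that
induction on m works. -/
theorem sum_sq_mul_descFactorial {n m : ℕ} (hn : 1 ≤ n) (hm : m ≤ n) :
    ∑ k ∈ Finset.Icc 1 m, (k : ℝ) ^ 2 * ((n.descFactorial k : ℝ) / (n : ℝ) ^ k) / n =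
      ∑ k ∈ Finset.range (m + 1), (n.descFactorial k : ℝ) / (n : ℝ) ^ k - 1
        - m * ((n.descFactorial (m + 1) : ℝ) / (n : ℝ) ^ (m + 1)) := by
  have : (n : ℝ) ≠ 0 := by positivity
  induction m with
  | zero => simp
  | succ m ih =>
    rw [Finset.sum_Icc_succ_top (by omega), ih (by omega), Finset.sum_range_succ _ (m + 1),
      descFactorial_succ_div hn hm]
    push_cast
    ring

theorem kappa_eq {n : ℕ} (hn : 1 ≤ n) :
    kappa n = ∑ k ∈ Finset.range (n + 1), (n.descFactorial k : ℝ) / (n : ℝ) ^ k - 2 / 3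
      - √(Real.pi * n / 2) := by
  have h := sum_sq_mul_descFactorial hn le_rfl
  -- For m = n the boundary term vanishes.
  rw [Nat.descFactorial_of_lt (Nat.lt_succ_self n)] at h
  have h2 : ∑ k ∈ Finset.Icc 1 n,
      ((n ! : ℝ) * (k : ℝ) ^ 2) / (((n - k)! : ℝ) * (n : ℝ) ^ (k + 1)) =
      ∑ k ∈ Finset.Icc 1 n, (k : ℝ) ^ 2 * ((n.descFactorial k : ℝ) / (n : ℝ) ^ k) / n := by
    refine Finset.sum_congr rfl fun k hk => ?_
    have : (n : ℝ) ≠ 0 := by positivity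
    have hf : ((n - k)! : ℝ) ≠ 0 := by positivity
    rw [← Nat.factorial_mul_descFactorial (Finset.mem_Icc.1 hk).2]
    push_cast
    field_simp
    ring
  rw [kappa, h2, h]
  simp
  ring

theorem delta_eq {n : ℕ} (hn : 1 ≤ n) :
    delta n = ∑ k ∈ Finset.range n, (n.descFactorial k : ℝ) / (n : ℝ) ^ k - 2 / 3
      - √(Real.pi * n / 2) := by
  rw [delta, kappa_eq hn, Finset.sum_range_succ, Nat.descFactorial_self]
  ring

/-! ### The phase function y - log(1+y) -/

theorem nonneg_of_hasDerivAt_nonneg {f f' : ℝ → ℝ} {a : ℝ} (h0 : 0 ≤ f a)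
    (hd : ∀ y, a ≤ y → HasDerivAt f (f' y) y) (hpos : ∀ y, a < y → 0 ≤ f' y) {y : ℝ}
    (hy : a ≤ y) : 0 ≤ f y := by
  have : MonotoneOn f (Set.Ici a) := by
    apply monotoneOn_of_deriv_nonneg (convex_Ici a)
    · exact fun z hz => (hd z hz).continuousAt.continuousWithinAt
    · intro z hz
      rw [interior_Ici] at hz
      exact (hd z (le_of_lt hz)).differentiableAt.differentiableWithinAt
    · intro z hz
      rw [interior_Ici] at hz
      rw [(hd z (le_of_lt hz)).deriv]
      exact hpos z hz
  exact h0.trans (this Set.self_mem_Ici hy hy)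

/-- The function `y - log (1 + y)`. -/
noncomputable def logGap (y : ℝ) : ℝ := y - Real.log (1 + y)

@[simp] theorem logGap_zero : logGap 0 = 0 := by simp [logGap]

theorem hasDerivAt_logGap {y : ℝ} (hy : 0 ≤ y) : HasDerivAt logGap (y / (1 + y)) y := by
  have h1 : (1 + y) ≠ 0 := by positivity
  have := (hasDerivAt_id y).sub (((hasDerivAt_id y).const_add 1).log h1)
  refine this.congr_deriv ?_
  simp only [id]
  field_simp
  ring

theorem logGap_le {y : ℝ} (hy : 0 ≤ y) : logGap y ≤ y ^ 2 / 2 - y ^ 3 / 3 + y ^ 4 / 4 := by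
  have := nonneg_of_hasDerivAt_nonneg
    (f := fun y => y ^ 2 / 2 - y ^ 3 / 3 + y ^ 4 / 4 - logGap y)
    (f' := fun y => y - y ^ 2 + y ^ 3 - y / (1 + y)) (a := 0) (by simp) (fun y hy => by
      refine ((((((hasDerivAt_id y).pow 2).div_const 2).sub
        (((hasDerivAt_id y).pow 3).div_const 3)).add
        (((hasDerivAt_id y).pow 4).div_const 4)).sub (hasDerivAt_logGap hy)).congr_deriv ?_
      simp only [id]
      ring) (fun y hy => by
      rw [sub_nonneg, div_le_iff₀ (by positivity)]
      nlinarith [pow_pos hy 4]) hy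
  simpa using this

theorem le_logGap {y : ℝ} (hy : 0 ≤ y) : y ^ 2 / 2 - y ^ 3 / 3 ≤ logGap y := by
  have := nonneg_of_hasDerivAt_nonneg
    (f := fun y => logGap y - (y ^ 2 / 2 - y ^ 3 / 3))
    (f' := fun y => y / (1 + y) - (y - y ^ 2)) (a := 0) (by simp) (fun y hy => by
      refine ((hasDerivAt_logGap hy).sub ((((hasDerivAt_id y).pow 2).div_const 2).sub
        (((hasDerivAt_id y).pow 3).div_const 3))).congr_deriv ?_
      simp only [id]
      ring) (fun y hy => by
      rw [sub_nonneg, le_div_iff₀ (by positivity)]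
      nlinarith [pow_pos hy 3]) hy
  simpa using this

theorem logGap_strictMonoOn : StrictMonoOn logGap (Set.Ici 0) := by
  apply strictMonoOn_of_deriv_pos (convex_Ici 0)
  · exact fun z hz => (hasDerivAt_logGap hz).continuousAt.continuousWithinAt
  · intro z hz
    rw [interior_Ici] at hz
    have hz' : 0 < z := hz
    rw [(hasDerivAt_logGap hz'.le).deriv]
    positivity

theorem logGap_pos {y : ℝ} (hy : 0 < y) : 0 < logGap y := by
  simpa using logGap_strictMonoOn Set.self_mem_Ici hy.le hy

theorem tendsto_logGap_atTop : Tendsto logGap atTop atTop := by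
  have h : Tendsto (fun y : ℝ => y / 2 - 1 / 2) atTop atTop :=
    tendsto_atTop_add_const_right _ _ (tendsto_id.atTop_div_const two_pos)
  refine tendsto_atTop_mono' _ ?_ h
  filter_upwards [eventually_gt_atTop 0] with y hy
  -- Splitting off log 2 yields a linear upper bound of slope 1/2 for the logarithm.
  have h1 : Real.log (1 + y) = Real.log 2 + Real.log ((1 + y) / 2) := by
    rw [← Real.log_mul (by norm_num) (by positivity)]
    congr 1
    ring
  have h2 := Real.log_le_sub_one_of_pos (x := (1 + y) / 2) (by positivity)
  have h3 := Real.log_le_sub_one_of_pos (x := 2) (by norm_num)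
  rw [logGap, h1]
  linarith

/-! ### The Gaussian change of variables -/

/-- The change of variables `√(2 (y - log (1 + y)))`, which turns `exp (-n (y - log (1 + y)))` into
a Gaussian. -/
noncomputable def sqrtGap (y : ℝ) : ℝ := √(2 * logGap y)

@[simp] theorem sqrtGap_zero : sqrtGap 0 = 0 := by simp [sqrtGap]

theorem sqrtGap_pos {y : ℝ} (hy : 0 < y) : 0 < sqrtGap y :=
  Real.sqrt_pos.2 (mul_pos two_pos (logGap_pos hy))

theorem sqrtGap_sq {y : ℝ} (hy : 0 ≤ y) : sqrtGap y ^ 2 = 2 * logGap y := by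
  rcases hy.eq_or_lt with rfl | hy
  · simp
  · exact Real.sq_sqrt (mul_pos two_pos (logGap_pos hy)).le

theorem tendsto_sqrtGap_atTop : Tendsto sqrtGap atTop atTop :=
  Real.tendsto_sqrt_atTop.comp (tendsto_logGap_atTop.const_mul_atTop two_pos)

theorem hasDerivAt_sqrtGap {y : ℝ} (hy : 0 < y) :
    HasDerivAt sqrtGap (y / ((1 + y) * sqrtGap y)) y := by
  have h := ((hasDerivAt_logGap hy.le).const_mul 2).sqrt (mul_pos two_pos (logGap_pos hy)).ne'
  refine h.congr_deriv ?_
  have := sqrtGap_pos hy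
  rw [← sqrtGap]
  field_simp

theorem continuousAt_sqrtGap {y : ℝ} (hy : 0 ≤ y) : ContinuousAt sqrtGap y :=
  ((hasDerivAt_logGap hy).continuousAt.const_mul 2).sqrt

/-- This is the positivity of `kernel`. With w = (1+y)^(1/3) the claim becomes 2(w³ - 1 - 3 log w) ≤
(w² - 1/w)². Both sides vanish at w = 1, and the derivative of the difference contains 2w³ - 3w² + 1
= (w-1)²(2w+1), hence is nonnegative. -/
theorem sqrtGap_pow_three_mul_le {y : ℝ} (hy : 0 ≤ y) : sqrtGap y ^ 3 * (1 + y) ≤ y ^ 3 := by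
  obtain ⟨w, hw1, hw⟩ : ∃ w : ℝ, 1 ≤ w ∧ w ^ 3 = 1 + y := by
    refine ⟨(1 + y) ^ ((3 : ℕ) : ℝ)⁻¹, Real.one_le_rpow (by linarith) (by positivity), ?_⟩
    exact Real.rpow_inv_natCast_pow (by positivity) (by norm_num)
  have hw0 : 0 < w := by linarith
  have hlog : Real.log (1 + y) = 3 * Real.log w := by
    rw [← hw, Real.log_pow]; norm_num
  have key := nonneg_of_hasDerivAt_nonneg
    (f := fun w => (w ^ 2 - w⁻¹) ^ 2 - 2 * (w ^ 3 - 1 - 3 * Real.log w))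
    (f' := fun w => 2 * (w ^ 3 - 1) / w ^ 3 * ((w - 1) ^ 2 * (2 * w + 1))) (a := 1) (by simp)
    (fun w hw => by
      have hw0 : w ≠ 0 := by positivity
      refine (((((hasDerivAt_id w).pow 2).sub (hasDerivAt_inv hw0)).pow 2).sub
        (((((hasDerivAt_id w).pow 3).sub_const 1).sub
          ((Real.hasDerivAt_log hw0).const_mul 3)).const_mul 2)).congr_deriv ?_
      simp only [id, Pi.pow_apply, Pi.sub_apply, Nat.reduceSub, pow_one]
      push_cast
      field_simp
      ring) (fun w hw => by
      have : 1 ≤ w ^ 3 := one_le_pow₀ hw.le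
      have hw0 : 0 < w := by linarith
      have : 0 ≤ w ^ 3 - 1 := by linarith
      positivity) hw1
  have h1 : (sqrtGap y * w) ^ 2 ≤ y ^ 2 := by
    have h2 : y ^ 2 = w ^ 2 * (w ^ 2 - w⁻¹) ^ 2 := by
      have : y = w ^ 3 - 1 := by linarith
      rw [this]
      field_simp
    rw [mul_pow, sqrtGap_sq hy, logGap, hlog, h2, mul_comm]
    refine mul_le_mul_of_nonneg_left ?_ (by positivity)
    have h3 : y = w ^ 3 - 1 := by linarith
    rw [h3]
    linarith
  have h4 : sqrtGap y * w ≤ y := le_of_sq_le_sq h1 hy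
  rw [← hw, ← mul_pow]
  exact pow_le_pow_left₀ (mul_nonneg (Real.sqrt_nonneg _) hw0.le) h4 3

/-! ### The kernel and its primitive -/

/-- The function `1 / y - 1 / √(2 (y - log (1 + y))) + 1 / 3`, extended continuously to `0`. -/
noncomputable def kernelPrimitive (y : ℝ) : ℝ :=
  if y = 0 then 0 else 1 / y - 1 / sqrtGap y + 1 / 3

/-- The density whose Laplace-type transform is `kappa`. -/
noncomputable def kernel (y : ℝ) : ℝ := y / ((1 + y) * sqrtGap y ^ 3) - 1 / y ^ 2

theorem kernelPrimitive_of_pos {y : ℝ} (hy : 0 < y) :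
    kernelPrimitive y = 1 / y - 1 / sqrtGap y + 1 / 3 := if_neg hy.ne'

theorem kernel_nonneg {y : ℝ} (hy : 0 < y) : 0 ≤ kernel y := by
  have := sqrtGap_pos hy
  rw [kernel, sub_nonneg, div_le_div_iff₀ (by positivity) (by positivity)]
  linarith [sqrtGap_pow_three_mul_le hy.le]

theorem hasDerivAt_kernelPrimitive {y : ℝ} (hy : 0 < y) :
    HasDerivAt kernelPrimitive (kernel y) y := by
  have hu := sqrtGap_pos hy
  have h : HasDerivAt (fun y => y⁻¹ - (sqrtGap y)⁻¹ + 1 / 3) (kernel y) y := by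
    refine (((hasDerivAt_inv hy.ne').sub ((hasDerivAt_sqrtGap hy).inv hu.ne')).add_const
      _).congr_deriv ?_
    rw [kernel]
    field_simp
    ring
  refine h.congr_of_eventuallyEq ?_
  filter_upwards [lt_mem_nhds hy] with z hz
  rw [kernelPrimitive_of_pos hz, one_div, one_div]

theorem tendsto_kernelPrimitive_zero : Tendsto kernelPrimitive (𝓝[>] 0) (𝓝 0) := by
  -- With q = `sqrtGap y / y` one has q² = 1 + y·r and 1/y - 1/`sqrtGap y` = r/(q(q+1)). The cubic
  -- Taylor term gives r → -2/3, so this tends to -1/3.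
  set r : ℝ → ℝ := fun y => (2 * logGap y / y ^ 2 - 1) / y with hr
  have hid : Tendsto (fun y : ℝ => y) (𝓝[>] 0) (𝓝 0) := tendsto_id.mono_left nhdsWithin_le_nhds
  have hrlim : Tendsto r (𝓝[>] 0) (𝓝 (-2 / 3)) := by
    have hup : Tendsto (fun y : ℝ => -2 / 3 + y / 2) (𝓝[>] 0) (𝓝 (-2 / 3)) := by
      simpa using (hid.div_const 2).const_add (-2 / 3)
    refine tendsto_of_tendsto_of_tendsto_of_le_of_le' tendsto_const_nhds hup ?_ ?_
    · filter_upwards [self_mem_nhdsWithin] with y (hy : 0 < y)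
      have := le_logGap hy.le
      rw [hr]
      simp only
      rw [le_div_iff₀ hy, le_sub_iff_add_le, le_div_iff₀ (by positivity)]
      nlinarith
    · filter_upwards [self_mem_nhdsWithin] with y (hy : 0 < y)
      have := logGap_le hy.le
      rw [hr]
      simp only
      rw [div_le_iff₀ hy, sub_le_iff_le_add, div_le_iff₀ (by positivity)]
      nlinarith
  have hq : Tendsto (fun y => √(1 + y * r y)) (𝓝[>] 0) (𝓝 1) := by
    simpa using ((hid.mul hrlim).const_add 1).sqrt
  have hlim : Tendsto (fun y => r y / (√(1 + y * r y) * (√(1 + y * r y) + 1)) + 1 / 3)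
      (𝓝[>] 0) (𝓝 0) := by
    have := (hrlim.div (hq.mul (hq.add_const 1)) (by norm_num)).add_const (1 / 3)
    norm_num at this
    simpa using this
  refine hlim.congr' ?_
  filter_upwards [self_mem_nhdsWithin] with y (hy : 0 < y)
  have hu := sqrtGap_pos hy
  have hu2 := sqrtGap_sq hy.le
  have h1 : 1 + y * r y = (sqrtGap y / y) ^ 2 := by
    rw [div_pow, hu2, hr]
    field_simp
    ring
  have h2 : r y = ((sqrtGap y / y) ^ 2 - 1) / y := by
    rw [← h1]
    field_simp
    ring
  rw [h1, Real.sqrt_sq (by positivity), h2, kernelPrimitive_of_pos hy]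
  field_simp
  ring

theorem continuousWithinAt_kernelPrimitive :
    ContinuousWithinAt kernelPrimitive (Set.Ici 0) 0 := by
  rw [← continuousWithinAt_Ioi_iff_Ici, ContinuousWithinAt]
  simpa [kernelPrimitive] using tendsto_kernelPrimitive_zero

theorem tendsto_kernelPrimitive_atTop : Tendsto kernelPrimitive atTop (𝓝 (1 / 3)) := by
  have h := (tendsto_inv_atTop_zero.sub
    (tendsto_inv_atTop_zero.comp tendsto_sqrtGap_atTop)).add_const (1 / 3 : ℝ)
  rw [sub_zero, zero_add] at h
  refine h.congr' ?_
  filter_upwards [eventually_gt_atTop 0] with y hy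
  simp only [kernelPrimitive_of_pos hy, one_div, Function.comp_apply]

theorem integrableOn_kernel : IntegrableOn kernel (Set.Ioi 0) :=
  integrableOn_Ioi_deriv_of_nonneg continuousWithinAt_kernelPrimitive
    (fun _ hy => hasDerivAt_kernelPrimitive hy) (fun _ hy => kernel_nonneg hy)
    tendsto_kernelPrimitive_atTop

/-! ### The three integrals that make up κ -/

theorem integral_pow_mul_exp_neg_mul (k : ℕ) {r : ℝ} (hr : 0 < r) :
    ∫ y in Set.Ioi (0 : ℝ), y ^ k * Real.exp (-(r * y)) = (k ! : ℝ) / r ^ (k + 1) := by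
  have h := Real.integral_rpow_mul_exp_neg_mul_Ioi (a := (k : ℝ) + 1) (by positivity) hr
  rw [Real.Gamma_nat_eq_factorial] at h
  simp only [add_sub_cancel_right, Real.rpow_natCast] at h
  rw [h]
  have : (1 / r) ^ ((k : ℝ) + 1) = (1 / r) ^ (k + 1) := by
    rw [← Real.rpow_natCast]; push_cast; rfl
  rw [this, one_div, inv_pow]
  ring

theorem integrableOn_pow_mul_exp_neg_mul (k : ℕ) {r : ℝ} (hr : 0 < r) :
    IntegrableOn (fun y : ℝ => y ^ k * Real.exp (-(r * y))) (Set.Ioi 0) := by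
  -- A non-integrable function has integral 0 by convention, which contradicts the positive value
  -- just computed.
  by_contra h
  have h1 := integral_pow_mul_exp_neg_mul k hr
  rw [integral_undef h] at h1
  have : 0 < (k ! : ℝ) / r ^ (k + 1) := by positivity
  linarith

theorem exp_neg_mul_logGap (n : ℕ) {y : ℝ} (hy : 0 < y) :
    Real.exp (-(n * logGap y)) =
      ∑ k ∈ Finset.range (n + 1), (n.choose k : ℝ) * (y ^ k * Real.exp (-(n * y))) := by
  have h1 : Real.exp (-(n * logGap y)) = (y + 1) ^ n * Real.exp (-(n * y)) := by
    rw [logGap, add_comm y 1, ← Real.exp_log (show 0 < 1 + y by positivity), ← Real.exp_nat_mul,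
      ← Real.exp_add, Real.exp_log (by positivity)]
    congr 1
    ring
  rw [h1, add_pow, Finset.sum_mul]
  refine Finset.sum_congr rfl fun k _ => ?_
  rw [one_pow]
  ring

theorem integrableOn_exp_neg_mul_logGap {n : ℕ} (hn : 1 ≤ n) :
    IntegrableOn (fun y => Real.exp (-(n * logGap y))) (Set.Ioi 0) := by
  have hn' : (0 : ℝ) < n := by positivity
  refine IntegrableOn.congr_fun ?_ (fun y hy => (exp_neg_mul_logGap n hy).symm) measurableSet_Ioi
  exact integrable_finsetSum _ fun k _ => (integrableOn_pow_mul_exp_neg_mul k hn').const_mul _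

/-- The integrand is (1+y)^n e^{-ny}; the binomial expansion reduces it to Gamma integrals. -/
theorem integral_exp_neg_mul_logGap {n : ℕ} (hn : 1 ≤ n) :
    n * ∫ y in Set.Ioi (0 : ℝ), Real.exp (-(n * logGap y)) =
      ∑ k ∈ Finset.range (n + 1), (n.descFactorial k : ℝ) / (n : ℝ) ^ k := by
  have hn' : (0 : ℝ) < n := by positivity
  rw [setIntegral_congr_fun measurableSet_Ioi (fun y hy => exp_neg_mul_logGap n hy),
    integral_finsetSum _ fun k _ => (integrableOn_pow_mul_exp_neg_mul k hn').const_mul _,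
    Finset.mul_sum]
  refine Finset.sum_congr rfl fun k _ => ?_
  rw [integral_const_mul, integral_pow_mul_exp_neg_mul k hn', Nat.descFactorial_eq_factorial_mul_choose]
  push_cast
  field_simp
  ring

theorem hasDerivAt_exp_neg_mul_logGap (c : ℝ) {y : ℝ} (hy : 0 ≤ y) :
    HasDerivAt (fun y => Real.exp (-(c * logGap y)))
      (-(c * (y / (1 + y)) * Real.exp (-(c * logGap y)))) y := by
  refine ((hasDerivAt_logGap hy).const_mul c).neg.exp.congr_deriv ?_
  simp only [Pi.neg_apply]
  ring

theorem tendsto_exp_neg_mul_logGap {c : ℝ} (hc : 0 < c) :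
    Tendsto (fun y => Real.exp (-(c * logGap y))) atTop (𝓝 0) :=
  Real.tendsto_exp_neg_atTop_nhds_zero.comp (tendsto_logGap_atTop.const_mul_atTop hc)

theorem integral_deriv_exp_neg_mul_logGap {c : ℝ} (hc : 0 < c) :
    IntegrableOn (fun y => c * (y / (1 + y)) * Real.exp (-(c * logGap y))) (Set.Ioi 0) ∧
      ∫ y in Set.Ioi (0 : ℝ), c * (y / (1 + y)) * Real.exp (-(c * logGap y)) = 1 := by
  have hd : ∀ y ∈ Set.Ici (0 : ℝ), HasDerivAt (fun y => -Real.exp (-(c * logGap y)))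
      (c * (y / (1 + y)) * Real.exp (-(c * logGap y))) y := fun y hy => by
    exact (hasDerivAt_exp_neg_mul_logGap c hy).neg.congr_deriv (neg_neg _)
  have hpos : ∀ y ∈ Set.Ioi (0 : ℝ), 0 ≤ c * (y / (1 + y)) * Real.exp (-(c * logGap y)) := by
    intro y (hy : 0 < y)
    positivity
  have hlim := (tendsto_exp_neg_mul_logGap hc).neg
  refine ⟨integrableOn_Ioi_deriv_of_nonneg' hd hpos hlim, ?_⟩
  rw [integral_Ioi_of_hasDerivAt_of_nonneg' hd hpos hlim]
  simp

/-- Substituting t = `sqrtGap y` gives a half-line Gaussian integral. It is carried out through a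
primitive, which needs only continuity at 0, where the derivative formula for `sqrtGap` is not
available. -/
theorem integral_gaussian_sqrtGap {c : ℝ} (hc : 0 < c) :
    IntegrableOn (fun y => Real.exp (-(c * logGap y)) * (y / ((1 + y) * sqrtGap y))) (Set.Ioi 0) ∧
      c * ∫ y in Set.Ioi (0 : ℝ), Real.exp (-(c * logGap y)) * (y / ((1 + y) * sqrtGap y)) =
        √(Real.pi * c / 2) := by
  set f : ℝ → ℝ := fun t => Real.exp (-(c / 2) * t ^ 2) with hf
  have hfc : Continuous f := by fun_prop
  have hΦ : ∀ t, HasDerivAt (fun t => ∫ u in (0 : ℝ)..t, f u) (f t) t := fun t =>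
    (hfc.integral_hasStrictDerivAt 0 t).hasDerivAt
  have hd : ∀ y ∈ Set.Ioi (0 : ℝ), HasDerivAt (fun y => ∫ u in (0 : ℝ)..sqrtGap y, f u)
      (Real.exp (-(c * logGap y)) * (y / ((1 + y) * sqrtGap y))) y := by
    intro y hy
    refine ((hΦ (sqrtGap y)).comp y (hasDerivAt_sqrtGap hy)).congr_deriv ?_
    rw [hf]
    simp only
    rw [sqrtGap_sq (le_of_lt hy)]
    congr 2
    ring
  have hcont : ContinuousWithinAt (fun y => ∫ u in (0 : ℝ)..sqrtGap y, f u) (Set.Ici 0) 0 :=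
    ((hΦ (sqrtGap 0)).continuousAt.comp (continuousAt_sqrtGap le_rfl)).continuousWithinAt
  have hpos : ∀ y ∈ Set.Ioi (0 : ℝ),
      0 ≤ Real.exp (-(c * logGap y)) * (y / ((1 + y) * sqrtGap y)) := by
    intro y (hy : 0 < y)
    have := sqrtGap_pos hy
    positivity
  have hlim : Tendsto (fun y => ∫ u in (0 : ℝ)..sqrtGap y, f u) atTop
      (𝓝 (∫ u in Set.Ioi (0 : ℝ), f u)) :=
    intervalIntegral_tendsto_integral_Ioi 0 (integrable_exp_neg_mul_sq (half_pos hc)).integrableOn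
      tendsto_sqrtGap_atTop
  refine ⟨integrableOn_Ioi_deriv_of_nonneg hcont hd hpos hlim, ?_⟩
  rw [integral_Ioi_of_hasDerivAt_of_nonneg hcont hd hpos hlim, hf, integral_gaussian_Ioi]
  simp only [sqrtGap_zero, intervalIntegral.integral_same, sub_zero]
  symm
  rw [Real.sqrt_eq_iff_mul_self_eq (by positivity) (by positivity)]
  symm
  have h := Real.mul_self_sqrt (show 0 ≤ Real.pi / (c / 2) by positivity)
  calc _ = c ^ 2 / 4 * (√(Real.pi / (c / 2)) * √(Real.pi / (c / 2))) := by ring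
    _ = _ := by
      rw [h]
      field_simp
      norm_num

/-! ### κ as an integral of a positive kernel; limits -/

theorem exp_neg_mul_logGap_le_one (n : ℕ) {y : ℝ} (hy : 0 < y) :
    Real.exp (-(n * logGap y)) ≤ 1 := by
  have := logGap_pos hy
  exact Real.exp_le_one_iff.2 (neg_nonpos.2 (by positivity))

theorem continuousOn_exp_neg_mul_logGap (c : ℝ) :
    ContinuousOn (fun y => Real.exp (-(c * logGap y))) (Set.Ioi 0) := fun _ hy =>
  (hasDerivAt_exp_neg_mul_logGap c (le_of_lt hy)).continuousAt.continuousWithinAt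

theorem aestronglyMeasurable_exp_mul_kernel (c : ℝ) :
    AEStronglyMeasurable (fun y => Real.exp (-(c * logGap y)) * kernel y)
      (volume.restrict (Set.Ioi 0)) :=
  ((continuousOn_exp_neg_mul_logGap c).aestronglyMeasurable measurableSet_Ioi).mul
    integrableOn_kernel.aestronglyMeasurable

theorem norm_exp_mul_kernel_le (n : ℕ) {y : ℝ} (hy : 0 < y) :
    ‖Real.exp (-(n * logGap y)) * kernel y‖ ≤ kernel y := by
  have h := kernel_nonneg hy
  rw [Real.norm_of_nonneg (by positivity)]
  exact mul_le_of_le_one_left h (exp_neg_mul_logGap_le_one n hy)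

theorem integrableOn_exp_mul_kernel (n : ℕ) :
    IntegrableOn (fun y => Real.exp (-(n * logGap y)) * kernel y) (Set.Ioi 0) :=
  Integrable.mono' integrableOn_kernel (aestronglyMeasurable_exp_mul_kernel n)
    ((ae_restrict_iff' measurableSet_Ioi).2 (Eventually.of_forall fun _ hy =>
      norm_exp_mul_kernel_le n hy))

theorem kappa_eq_integral {n : ℕ} (hn : 1 ≤ n) :
    kappa n = ∫ y in Set.Ioi (0 : ℝ), Real.exp (-(n * logGap y)) * kernel y := by
  have hn' : (0 : ℝ) < n := by positivity
  obtain ⟨hB, hB'⟩ := integral_gaussian_sqrtGap hn'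
  obtain ⟨hC, hC'⟩ := integral_deriv_exp_neg_mul_logGap hn'
  have hA := integrableOn_exp_neg_mul_logGap hn
  have hG := integrableOn_exp_mul_kernel n
  set A : ℝ → ℝ := fun y => Real.exp (-(n * logGap y)) with hAdef
  set B : ℝ → ℝ := fun y => Real.exp (-(n * logGap y)) * (y / ((1 + y) * sqrtGap y)) with hBdef
  set C : ℝ → ℝ := fun y => n * (y / (1 + y)) * Real.exp (-(n * logGap y)) with hCdef
  set D : ℝ → ℝ := fun y => Real.exp (-(n * logGap y)) * kernel y with hDdef
  -- Integration by parts: the bracket equals `C y * kernelPrimitive y`, because (y/(1+y))·(1/y) = 1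
  -- - y/(1+y). Both boundary values of the product are 0.
  have hd : ∀ y ∈ Set.Ioi (0 : ℝ), HasDerivAt (fun y => A y * kernelPrimitive y)
      (D y - (n * A y - n * B y - 2 / 3 * C y)) y := by
    intro y (hy : 0 < y)
    refine ((hasDerivAt_exp_neg_mul_logGap n hy.le).mul
      (hasDerivAt_kernelPrimitive hy)).congr_deriv ?_
    have hu := sqrtGap_pos hy
    simp only [hAdef, hBdef, hCdef, hDdef]
    rw [kernelPrimitive_of_pos hy]
    field_simp
    ring
  have hAB : IntegrableOn (fun y => n * A y - n * B y) (Set.Ioi 0) :=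
    (hA.const_mul _).sub (hB.const_mul _)
  have hABC : IntegrableOn (fun y => n * A y - n * B y - 2 / 3 * C y) (Set.Ioi 0) :=
    hAB.sub (hC.const_mul _)
  have hcont : ContinuousWithinAt (fun y => A y * kernelPrimitive y) (Set.Ici 0) 0 :=
    (hasDerivAt_exp_neg_mul_logGap n le_rfl).continuousAt.continuousWithinAt.mul
      continuousWithinAt_kernelPrimitive
  have hlim := (tendsto_exp_neg_mul_logGap hn').mul tendsto_kernelPrimitive_atTop
  have h := integral_Ioi_of_hasDerivAt_of_tendsto hcont hd (hG.sub hABC) hlim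
  rw [integral_sub hG hABC, integral_sub hAB (hC.const_mul _),
    integral_sub (hA.const_mul _) (hB.const_mul _), integral_const_mul, integral_const_mul,
    integral_const_mul, integral_exp_neg_mul_logGap hn, hB', hC'] at h
  rw [kappa_eq hn]
  simp only [kernelPrimitive, if_true, mul_zero, zero_mul] at h
  linarith

theorem tendsto_kappa : Tendsto kappa atTop (𝓝 0) := by
  have h : Tendsto (fun n : ℕ => ∫ y in Set.Ioi (0 : ℝ), Real.exp (-(n * logGap y)) * kernel y)
      atTop (𝓝 (∫ _ in Set.Ioi (0 : ℝ), 0)) := by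
    refine tendsto_integral_of_dominated_convergence kernel
      (fun n => aestronglyMeasurable_exp_mul_kernel n) integrableOn_kernel (fun n => ?_) ?_
    · exact (ae_restrict_iff' measurableSet_Ioi).2 (Eventually.of_forall fun _ hy =>
        norm_exp_mul_kernel_le n hy)
    · refine (ae_restrict_iff' measurableSet_Ioi).2 (Eventually.of_forall fun y hy => ?_)
      have h1 : Tendsto (fun n : ℕ => (n : ℝ) * logGap y) atTop atTop :=
        tendsto_natCast_atTop_atTop.atTop_mul_const (logGap_pos hy)
      simpa using (Real.tendsto_exp_neg_atTop_nhds_zero.comp h1).mul_const (kernel y)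
  rw [integral_zero] at h
  refine h.congr' ?_
  filter_upwards [eventually_ge_atTop 1] with n hn
  exact (kappa_eq_integral hn).symm

theorem tendsto_delta : Tendsto delta atTop (𝓝 0) := by
  have := tendsto_kappa.sub tendsto_factorial_div_pow_self_atTop
  rw [sub_zero] at this
  exact this

/-! ### Lower bound for the decrease of κ -/

/-- The difference is the integral of e^{-nL}(1 - e^{-L})·`kernel`, with L = `logGap`. The integrand
is nonnegative, so restrict to (a, b]; as L increases, bound the first factor by its value at b and
the second by its value at a. -/
theorem le_kappa_sub_kappa_succ {n : ℕ} (hn : 1 ≤ n) {a b : ℝ} (ha : 0 < a) (hab : a ≤ b) :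
    Real.exp (-(n * logGap b)) * (1 - Real.exp (-logGap a)) *
      (kernelPrimitive b - kernelPrimitive a) ≤ kappa n - kappa (n + 1) := by
  have hI : IntegrableOn kernel (Set.Ioc a b) :=
    integrableOn_kernel.mono_set fun _ hy => ha.trans hy.1
  have h1 : kernelPrimitive b - kernelPrimitive a = ∫ y in Set.Ioc a b, kernel y := by
    rw [← intervalIntegral.integral_of_le hab]
    refine (intervalIntegral.integral_eq_sub_of_hasDerivAt (fun y hy => ?_) ?_).symm
    · rw [Set.uIcc_of_le hab] at hy
      exact hasDerivAt_kernelPrimitive (ha.trans_le hy.1)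
    · exact (intervalIntegrable_iff_integrableOn_Ioc_of_le hab).2 hI
  rw [kappa_eq_integral hn, kappa_eq_integral (by omega : 1 ≤ n + 1),
    ← integral_sub (integrableOn_exp_mul_kernel n) (integrableOn_exp_mul_kernel (n + 1)), h1,
    ← integral_const_mul]
  have hrw : ∀ y, Real.exp (-(n * logGap y)) * kernel y
      - Real.exp (-((n + 1 : ℕ) * logGap y)) * kernel y =
      Real.exp (-(n * logGap y)) * (1 - Real.exp (-logGap y)) * kernel y := by
    intro y
    have : Real.exp (-((n + 1 : ℕ) * logGap y)) =
        Real.exp (-(n * logGap y)) * Real.exp (-logGap y) := by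
      rw [← Real.exp_add]
      push_cast
      congr 1
      ring
    rw [this]
    ring
  have hint := (integrableOn_exp_mul_kernel n).sub (integrableOn_exp_mul_kernel (n + 1))
  have hexp : ∀ {y : ℝ}, 0 < y → Real.exp (-logGap y) ≤ 1 := fun hy => by
    simpa using exp_neg_mul_logGap_le_one 1 hy
  calc ∫ y in Set.Ioc a b, Real.exp (-(n * logGap b)) * (1 - Real.exp (-logGap a)) * kernel y
      ≤ ∫ y in Set.Ioc a b, (Real.exp (-(n * logGap y)) * kernel y
          - Real.exp (-((n + 1 : ℕ) * logGap y)) * kernel y) := by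
        refine setIntegral_mono_on (hI.const_mul _)
          (hint.mono_set fun _ hy => ha.trans hy.1) measurableSet_Ioc fun y hy => ?_
        have hy0 : 0 < y := ha.trans hy.1
        rw [hrw]
        refine mul_le_mul_of_nonneg_right ?_ (kernel_nonneg hy0)
        have m1 := logGap_strictMonoOn.monotoneOn hy0.le (hy0.le.trans hy.2) hy.2
        have m2 := logGap_strictMonoOn.monotoneOn ha.le hy0.le hy.1.le
        have := hexp ha
        gcongr
    _ ≤ _ := by
        refine setIntegral_mono_set hint ?_ ?_
        · refine (ae_restrict_iff' measurableSet_Ioi).2 (Eventually.of_forall fun y hy => ?_)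
          simp only [Pi.zero_apply]
          rw [hrw]
          have := hexp hy
          exact mul_nonneg (mul_nonneg (Real.exp_nonneg _) (by linarith)) (kernel_nonneg hy)
        · exact Eventually.of_forall fun _ hy => ha.trans hy.1

/-! ### Numerical comparison for n ≤ 15 -/

theorem sqrt_pi_mul_div_two_mem_Ioo {x lo hi : ℝ} (hx : 0 < x) (hlo : 0 ≤ lo) (hhi : 0 < hi)
    (h1 : lo ^ 2 < 3.14159265 * x / 2) (h2 : 3.14159266 * x / 2 < hi ^ 2) :
    lo < √(Real.pi * x / 2) ∧ √(Real.pi * x / 2) < hi := by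
  have hp1 := Real.pi_gt_d20
  have hp2 := Real.pi_lt_d20
  constructor
  · rw [Real.lt_sqrt hlo]
    refine h1.trans_le ?_
    gcongr
    linarith
  · rw [Real.sqrt_lt' hhi]
    refine lt_of_le_of_lt ?_ h2
    gcongr
    linarith

theorem delta_lt_delta_succ {n : ℕ} (h1 : 1 ≤ n) (h7 : n ≤ 7) : delta n < delta (n + 1) := by
  obtain ⟨a1, -⟩ := sqrt_pi_mul_div_two_mem_Ioo (x := 1) (lo := 1.253314) (hi := 1.253315)
    (by norm_num) (by norm_num) (by norm_num) (by norm_num) (by norm_num)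
  obtain ⟨a2, b2⟩ := sqrt_pi_mul_div_two_mem_Ioo (x := 2) (lo := 1.772453) (hi := 1.772454)
    (by norm_num) (by norm_num) (by norm_num) (by norm_num) (by norm_num)
  obtain ⟨a3, b3⟩ := sqrt_pi_mul_div_two_mem_Ioo (x := 3) (lo := 2.170803) (hi := 2.170804)
    (by norm_num) (by norm_num) (by norm_num) (by norm_num) (by norm_num)
  obtain ⟨a4, b4⟩ := sqrt_pi_mul_div_two_mem_Ioo (x := 4) (lo := 2.506628) (hi := 2.506629)
    (by norm_num) (by norm_num) (by norm_num) (by norm_num) (by norm_num)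
  obtain ⟨a5, b5⟩ := sqrt_pi_mul_div_two_mem_Ioo (x := 5) (lo := 2.802495) (hi := 2.802496)
    (by norm_num) (by norm_num) (by norm_num) (by norm_num) (by norm_num)
  obtain ⟨a6, b6⟩ := sqrt_pi_mul_div_two_mem_Ioo (x := 6) (lo := 3.069980) (hi := 3.069981)
    (by norm_num) (by norm_num) (by norm_num) (by norm_num) (by norm_num)
  obtain ⟨a7, b7⟩ := sqrt_pi_mul_div_two_mem_Ioo (x := 7) (lo := 3.315957) (hi := 3.315958)
    (by norm_num) (by norm_num) (by norm_num) (by norm_num) (by norm_num)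
  obtain ⟨-, b8⟩ := sqrt_pi_mul_div_two_mem_Ioo (x := 8) (lo := 3.544907) (hi := 3.544908)
    (by norm_num) (by norm_num) (by norm_num) (by norm_num) (by norm_num)
  rw [delta_eq h1, delta_eq (by omega)]
  interval_cases n <;>
  · simp only [Finset.sum_range_succ, Finset.sum_range_zero, Nat.descFactorial, Nat.reduceAdd,
      Nat.reduceSub, Nat.reduceMul, Nat.cast_ofNat, Nat.cast_one]
    linarith

theorem delta_succ_lt_delta_of_le_fifteen {n : ℕ} (h8 : 8 ≤ n) (h15 : n ≤ 15) :
    delta (n + 1) < delta n := by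
  obtain ⟨-, b8⟩ := sqrt_pi_mul_div_two_mem_Ioo (x := 8) (lo := 3.544907) (hi := 3.544908)
    (by norm_num) (by norm_num) (by norm_num) (by norm_num) (by norm_num)
  obtain ⟨a9, b9⟩ := sqrt_pi_mul_div_two_mem_Ioo (x := 9) (lo := 3.759942) (hi := 3.759943)
    (by norm_num) (by norm_num) (by norm_num) (by norm_num) (by norm_num)
  obtain ⟨a10, b10⟩ := sqrt_pi_mul_div_two_mem_Ioo (x := 10) (lo := 3.963327) (hi := 3.963328)
    (by norm_num) (by norm_num) (by norm_num) (by norm_num) (by norm_num)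
  obtain ⟨a11, b11⟩ := sqrt_pi_mul_div_two_mem_Ioo (x := 11) (lo := 4.156772) (hi := 4.156773)
    (by norm_num) (by norm_num) (by norm_num) (by norm_num) (by norm_num)
  obtain ⟨a12, b12⟩ := sqrt_pi_mul_div_two_mem_Ioo (x := 12) (lo := 4.341607) (hi := 4.341608)
    (by norm_num) (by norm_num) (by norm_num) (by norm_num) (by norm_num)
  obtain ⟨a13, b13⟩ := sqrt_pi_mul_div_two_mem_Ioo (x := 13) (lo := 4.518888) (hi := 4.518889)
    (by norm_num) (by norm_num) (by norm_num) (by norm_num) (by norm_num)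
  obtain ⟨a14, b14⟩ := sqrt_pi_mul_div_two_mem_Ioo (x := 14) (lo := 4.689472) (hi := 4.689473)
    (by norm_num) (by norm_num) (by norm_num) (by norm_num) (by norm_num)
  obtain ⟨a15, b15⟩ := sqrt_pi_mul_div_two_mem_Ioo (x := 15) (lo := 4.854064) (hi := 4.854065)
    (by norm_num) (by norm_num) (by norm_num) (by norm_num) (by norm_num)
  obtain ⟨a16, -⟩ := sqrt_pi_mul_div_two_mem_Ioo (x := 16) (lo := 5.013256) (hi := 5.013257)
    (by norm_num) (by norm_num) (by norm_num) (by norm_num) (by norm_num)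
  rw [delta_eq (by omega : 1 ≤ n), delta_eq (by omega : 1 ≤ n + 1)]
  interval_cases n <;>
  · simp only [Finset.sum_range_succ, Finset.sum_range_zero, Nat.descFactorial, Nat.reduceAdd,
      Nat.reduceSub, Nat.reduceMul, Nat.cast_ofNat, Nat.cast_one]
    linarith

/-! ### Comparison for n ≥ 16 -/

/-- The ratio of consecutive terms is (n/(n+1))^n, and (1 + 1/n)^n ≥ 2 by Bernoulli. -/
theorem factorial_div_pow_succ_le {n : ℕ} (hn : 1 ≤ n) :
    ((n + 1)! : ℝ) / ((n + 1 : ℕ) : ℝ) ^ (n + 1) ≤ 1 / 2 * ((n ! : ℝ) / (n : ℝ) ^ n) := by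
  have hn' : (0 : ℝ) < n := by positivity
  have h := one_add_mul_le_pow (a := 1 / (n : ℝ)) (by linarith [show 0 < 1 / (n : ℝ) by positivity]) n
  have h2 : 2 * (n : ℝ) ^ n ≤ ((n + 1 : ℕ) : ℝ) ^ n := by
    have h3 : ((n + 1 : ℕ) : ℝ) = n * (1 + 1 / n) := by
      push_cast
      field_simp
    rw [h3, mul_pow, mul_comm 2]
    gcongr
    refine le_trans (le_of_eq ?_) h
    field_simp
    norm_num
  rw [Nat.factorial_succ, pow_succ, Nat.cast_mul, mul_comm (((n + 1 : ℕ) : ℝ) ^ n),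
    mul_div_mul_left _ _ (by positivity), div_le_iff₀ (by positivity)]
  calc (n ! : ℝ) = 1 / 2 * ((n ! : ℝ) / (n : ℝ) ^ n) * (2 * (n : ℝ) ^ n) := by field_simp
    _ ≤ _ := by gcongr

theorem factorial_div_pow_le {n : ℕ} (hn : 16 ≤ n) :
    (n ! : ℝ) / (n : ℝ) ^ n ≤ 5 / 10000 * (73 / 100) ^ n := by
  induction n, hn using Nat.le_induction with
  | base => norm_num [Nat.factorial]
  | succ n hn ih =>
    refine (factorial_div_pow_succ_le (by omega)).trans ?_
    rw [pow_succ]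
    have : (0 : ℝ) < (73 / 100) ^ n := by positivity
    linarith

theorem le_kappa_sub_kappa_succ_explicit {n : ℕ} (hn : 1 ≤ n) :
    5 / 10000 * (73 / 100) ^ n ≤ kappa n - kappa (n + 1) := by
  -- The choice b = 1 gives e^{-L(1)} = 2/e > 0.73. The other two factors are at least 0.025 and
  -- 0.022, and 0.025 · 0.022 = 5.5/10000.
  refine le_trans ?_ (le_kappa_sub_kappa_succ hn (a := 1 / 4) (b := 1) (by norm_num) (by norm_num))
  have hexp : (73 / 100 : ℝ) ^ n ≤ Real.exp (-(n * logGap 1)) := by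
    have h1 : Real.exp (-(n * logGap 1)) = (2 * Real.exp (-1)) ^ n := by
      rw [← Real.exp_log (show (0 : ℝ) < 2 by norm_num), ← Real.exp_add, ← Real.exp_nat_mul,
        logGap, one_add_one_eq_two]
      congr 1
      ring
    rw [h1]
    refine pow_le_pow_left₀ (by norm_num) ?_ n
    have := Real.exp_neg_one_gt_d9
    linarith
  have hgap1 : (0.02604 : ℝ) ≤ logGap (1 / 4) := by
    refine le_trans ?_ (le_logGap (by norm_num))
    norm_num
  have hgap2 : logGap (1 / 4) ≤ 0.02703 := by
    refine (logGap_le (by norm_num)).trans ?_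
    norm_num
  have hgap3 : (0.30655 : ℝ) ≤ logGap 1 := by
    have := Real.log_two_lt_d9
    rw [logGap]
    norm_num at this ⊢
    linarith
  have hone : (0.025 : ℝ) ≤ 1 - Real.exp (-logGap (1 / 4)) := by
    have h1 : Real.exp (-logGap (1 / 4)) ≤ (1.02604 : ℝ)⁻¹ := by
      rw [Real.exp_neg]
      refine inv_anti₀ (by norm_num) ?_
      linarith [Real.add_one_le_exp (logGap (1 / 4))]
    norm_num at h1 ⊢
    linarith
  have hu1 : 0.783 ≤ sqrtGap 1 := by
    apply Real.le_sqrt_of_sq_le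
    linarith
  have hu2 : sqrtGap (1 / 4) ≤ 0.2326 := by
    refine Real.sqrt_le_iff.2 ⟨by norm_num, ?_⟩
    linarith
  have hk : (0.022 : ℝ) ≤ kernelPrimitive 1 - kernelPrimitive (1 / 4) := by
    rw [kernelPrimitive_of_pos one_pos, kernelPrimitive_of_pos (by norm_num)]
    have h1 : 1 / sqrtGap 1 ≤ 1 / 0.783 := one_div_le_one_div_of_le (by norm_num) hu1
    have h2 : 1 / 0.2326 ≤ 1 / sqrtGap (1 / 4) :=
      one_div_le_one_div_of_le (sqrtGap_pos (by norm_num)) hu2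
    norm_num at h1 h2 ⊢
    linarith
  calc (5 / 10000 * (73 / 100) ^ n : ℝ) ≤ (73 / 100) ^ n * 0.025 * 0.022 := by
        have : (0 : ℝ) < (73 / 100) ^ n := by positivity
        linarith
    _ ≤ _ := by gcongr

theorem delta_succ_lt_delta {n : ℕ} (hn : 8 ≤ n) : delta (n + 1) < delta n := by
  rcases le_or_gt n 15 with h | h
  · exact delta_succ_lt_delta_of_le_fifteen hn h
  · have h1 := le_kappa_sub_kappa_succ_explicit (by omega : 1 ≤ n)
    have h2 := factorial_div_pow_le (by omega : 16 ≤ n)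
    have h3 : 0 < ((n + 1)! : ℝ) / ((n + 1 : ℕ) : ℝ) ^ (n + 1) := by positivity
    rw [delta, delta]
    linarith

end LinearTest

theorem theorem11 :
    (∀ (n : ℕ), 1 ≤ n →
      ∀ (Ω : Type*) [MeasurableSpace Ω] (P : Measure Ω) [IsProbabilityMeasure P]
        (x : Fin n → Ω → Fin n),
        (∀ i, Measurable (x i)) →
        iIndepFun x P →
        (∀ i k, P.real {ω | x i ω = k} = 1 / (n : ℝ)) →
        ∀ (g₀ : Bool) (v₀ : Fin n → ℕ),
          ∫ ω, (LinearTest.runningTime g₀ v₀ (fun i => x i ω) : ℝ) ∂P =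
            n + √(2 * Real.pi * n) + 7 / 3 + 2 * LinearTest.delta n) ∧
    Tendsto LinearTest.delta atTop (𝓝 0) ∧
    (∀ n : ℕ, 1 ≤ n → n ≤ 7 → LinearTest.delta (n + 1) > LinearTest.delta n) ∧
    (∀ n : ℕ, 8 ≤ n → LinearTest.delta (n + 1) < LinearTest.delta n) := by
  refine ⟨fun n hn Ω _ P _ x hx hind hunif g₀ v₀ => ?_, LinearTest.tendsto_delta,
    fun n h1 h7 => LinearTest.delta_lt_delta_succ h1 h7,
    fun n hn => LinearTest.delta_succ_lt_delta hn⟩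
  have hsqrt : √(2 * Real.pi * n) = 2 * √(Real.pi * n / 2) := by
    rw [show 2 * Real.pi * n = 2 ^ 2 * (Real.pi * n / 2) by ring,
      Real.sqrt_mul (by norm_num), Real.sqrt_sq (by norm_num)]
  rw [LinearTest.integral_runningTime hx hind hunif, LinearTest.delta_eq hn, hsqrt]
  ring
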